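/- Let $p_1,q_1,r_1,p_2,q_2,r_2$ be positive integers and let $L$ be the alternating link obtained as the closure of the 4-braid $$\beta=\sigma_1^{p_1}\sigma_2^{-q_1}\sigma_3^{r_1}\sigma_1^{p_2}\sigma_2^{-q_2}\sigma_3^{r_2}.$$ For a positive integer $n$ put $[n]=\frac{1-s^n}{1-s}=1+s+\dots+s^{n-1}$. Then the Alexander polynomial $\Delta_L(t)\in\mathbb{Z}[t^{1/2},t^{-1/2}]$, given by $\Delta_L(t)=\left(\frac{-1}{\sqrt t}\right)^{e_\beta-3}\frac{1-t}{1-t^4}\det\left(I_3-\psi_{4,t}(\beta)\right)$ where $\psi_{4,t}$ is the reduced Burau representation of $B_4$ and $e_\beta$ is the exponent sum of $\beta$, is equal, after the substitution $s=-t$ and up to multiplication by a unit of $\mathbb{Z}[t^{1/2},t^{-1/2}]$, to $$\Delta_L(s)=s[q_1][q_2]\bigl([p_1][p_2][r_1+r_2]+[r_1][r_2][p_1+p_2]\bigr)+[p_1+p_2][q_1+q_2][r_1+r_2].$$ Write this polynomial as $\sum_{k=0}^{n}a_ks^{k+r}$ with $a_0\neq 0\neq a_n$. Then all $a_k$ are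 nonzero, the polynomial is symmetric ($a_k=a_{n-k}$ for $0\le k\le n$), and it is trapezoidal: there are $0\le i\le j\le n$ with $$a_0<a_1<\dots<a_i=a_{i+1}=\dots=a_j>a_{j+1}>\dots>a_n .$$ Moreover, the length $l$ of its stable part, that is, the largest integer $l$ such that $a_{k_0}=a_{k_0+1}=\dots=a_{k_0+l}$ for some $k_0\geq 0$ with $k_0+l\le n$, satisfies $l\leq|\sigma(L)|$, where $\sigma(L)$ is the signature of $L$, i.e. the signature of $V+V^{T}$ for the Seifert matrix $V$ of the Seifert surface of the closed braid diagram of $\beta$. -/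

import Mathlib

/-! ### Braids -/

/-- Defining relations of the braid group with generators `σ_0, …, σ_{k-1}`. -/
def braidRels (k : ℕ) : Set (FreeGroup (Fin k)) :=
  {r | ∃ i j : Fin k, (i : ℕ) + 2 ≤ j ∧
      r = (FreeGroup.of i * FreeGroup.of j) * (FreeGroup.of j * FreeGroup.of i)⁻¹} ∪
  {r | ∃ i j : Fin k, (i : ℕ) + 1 = j ∧
      r = (FreeGroup.of i * FreeGroup.of j * FreeGroup.of i) *
        (FreeGroup.of j * FreeGroup.of i * FreeGroup.of j)⁻¹}

/-- Artin's braid group on `k + 1` strands, with its `k` standard generators. -/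
abbrev BraidGroup (k : ℕ) : Type := PresentedGroup (braidRels k)

/-- A braid word on `k + 1` strands: the letter `(i, true)` is the generator with index `i`
(a positive crossing between the strands in positions `i` and `i + 1`), and `(i, false)` is
its inverse (a negative crossing). Indices start at `0`. -/
abbrev BraidWord (k : ℕ) : Type := List (Fin k × Bool)

/-- The braid represented by a word. -/
def BraidWord.toBraid {k : ℕ} (w : BraidWord k) : BraidGroup k :=
  PresentedGroup.mk (braidRels k) (FreeGroup.mk w)

/-- The exponent sum of a braid, as a homomorphism to the integers. -/
def braidExponentHom (k : ℕ) : BraidGroup k →* Multiplicative ℤ :=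
  PresentedGroup.toGroup (rels := braidRels k) (f := fun _ => Multiplicative.ofAdd (1 : ℤ)) (by
    rintro r (⟨i, j, -, rfl⟩ | ⟨i, j, -, rfl⟩) <;> simp)

/-- The exponent sum `e_b` of a braid `b`. -/
def braidExponentSum {k : ℕ} (b : BraidGroup k) : ℤ :=
  Multiplicative.toAdd (braidExponentHom k b)

/-! ### The reduced Burau representation of the braid group on four strands -/

section Burau

variable {R : Type*} [CommRing R]

/-- The reduced Burau matrices of the three generators. -/
def burauMatrix (t : Rˣ) : Fin 3 → Matrix (Fin 3) (Fin 3) R :=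
  ![!![-(t : R), 1, 0; 0, 1, 0; 0, 0, 1],
    !![1, 0, 0; (t : R), -(t : R), 1; 0, 0, 1],
    !![1, 0, 0; 0, 1, 0; 0, (t : R), -(t : R)]]

/-- The inverses of the reduced Burau matrices. -/
def burauMatrixInv (t : Rˣ) : Fin 3 → Matrix (Fin 3) (Fin 3) R :=
  ![!![-((t⁻¹ : Rˣ) : R), ((t⁻¹ : Rˣ) : R), 0; 0, 1, 0; 0, 0, 1],
    !![1, 0, 0; 1, -((t⁻¹ : Rˣ) : R), ((t⁻¹ : Rˣ) : R); 0, 0, 1],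
    !![1, 0, 0; 0, 1, 0; 0, 1, -((t⁻¹ : Rˣ) : R)]]

theorem burauMatrix_mul_inv (t : Rˣ) (i : Fin 3) :
    burauMatrix t i * burauMatrixInv t i = 1 := by
  fin_cases i <;> ext a b <;> fin_cases a <;> fin_cases b <;>
    simp [burauMatrix, burauMatrixInv, Matrix.mul_apply, Fin.sum_univ_three]

theorem burauMatrixInv_mul (t : Rˣ) (i : Fin 3) :
    burauMatrixInv t i * burauMatrix t i = 1 :=
  mul_eq_one_comm.mp (burauMatrix_mul_inv t i)

/-- The reduced Burau matrices as elements of `GL₃`. -/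
def burauGen (t : Rˣ) (i : Fin 3) : GL (Fin 3) R :=
  ⟨burauMatrix t i, burauMatrixInv t i, burauMatrix_mul_inv t i, burauMatrixInv_mul t i⟩

theorem burauGen_rels (t : Rˣ) :
    ∀ r ∈ braidRels 3, FreeGroup.lift (burauGen t) r = 1 := by
  rintro r (⟨i, j, h, rfl⟩ | ⟨i, j, h, rfl⟩)
  · simp only [map_mul, map_inv, FreeGroup.lift_apply_of, mul_inv_eq_one]
    apply Units.ext
    fin_cases i <;> fin_cases j <;> simp at h
    ext a b; fin_cases a <;> fin_cases b <;>
      simp [burauGen, burauMatrix, Matrix.mul_apply, Fin.sum_univ_three]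
  · simp only [map_mul, map_inv, FreeGroup.lift_apply_of, mul_inv_eq_one]
    apply Units.ext
    fin_cases i <;> fin_cases j <;> simp at h <;> ext a b <;> fin_cases a <;> fin_cases b <;>
      simp [burauGen, burauMatrix, Matrix.mul_apply, Fin.sum_univ_three]

/-- The reduced Burau representation of the braid group on four strands. -/
def burau (t : Rˣ) : BraidGroup 3 →* GL (Fin 3) R :=
  PresentedGroup.toGroup (burauGen_rels t)

/-- Modulo `1 + t + t² + t³` the representation fixes the vector `(1, 1 + t, 1 + t + t²)`. -/
theorem burau_fixes (t : Rˣ) (b : BraidGroup 3) :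
    ∃ y : Fin 3 → R,
      (burau t b : Matrix (Fin 3) (Fin 3) R).mulVec
          ![1, 1 + (t : R), 1 + (t : R) + (t : R) ^ 2] =
        ![1, 1 + (t : R), 1 + (t : R) + (t : R) ^ 2] +
          (1 + (t : R) + (t : R) ^ 2 + (t : R) ^ 3) • y := by
  have hb : b ∈ Subgroup.closure (Set.range (PresentedGroup.of (rels := braidRels 3))) := by
    rw [PresentedGroup.closure_range_of]; trivial
  induction hb using Subgroup.closure_induction with
  | mem x hx =>
    obtain ⟨i, rfl⟩ := hx
    refine ⟨![0, 0, if i = 2 then -1 else 0], ?_⟩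
    rw [burau, PresentedGroup.toGroup.of]
    fin_cases i <;> ext a <;> fin_cases a <;>
      simp [burauGen, burauMatrix, Matrix.mulVec, dotProduct, Fin.sum_univ_three] <;> ring
  | one => exact ⟨0, by simp⟩
  | mul x y _ _ hx hy =>
    obtain ⟨u, hu⟩ := hx
    obtain ⟨v, hv⟩ := hy
    refine ⟨u + (burau t x : Matrix (Fin 3) (Fin 3) R).mulVec v, ?_⟩
    rw [map_mul, Units.val_mul, ← Matrix.mulVec_mulVec, hv, Matrix.mulVec_add, hu,
      Matrix.mulVec_smul, smul_add, add_assoc]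
  | inv x _ hx =>
    obtain ⟨u, hu⟩ := hx
    refine ⟨-((burau t x)⁻¹ : GL (Fin 3) R).val.mulVec u, ?_⟩
    have h := congrArg (((burau t x)⁻¹ : GL (Fin 3) R).val.mulVec) hu
    rw [Matrix.mulVec_mulVec, Units.inv_mul, Matrix.one_mulVec, Matrix.mulVec_add,
      Matrix.mulVec_smul] at h
    rw [map_inv, smul_neg, ← sub_eq_add_neg, eq_sub_iff_add_eq, ← h]

theorem burau_dvd (t : Rˣ) (b : BraidGroup 3) :
    (1 + (t : R) + (t : R) ^ 2 + (t : R) ^ 3) ∣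
      (1 - (burau t b : Matrix (Fin 3) (Fin 3) R)).det := by
  obtain ⟨y, hy⟩ := burau_fixes t b
  have h : (1 - (burau t b : Matrix (Fin 3) (Fin 3) R)).mulVec
      ![1, 1 + (t : R), 1 + (t : R) + (t : R) ^ 2] =
        (1 + (t : R) + (t : R) ^ 2 + (t : R) ^ 3) • (-y) := by
    rw [Matrix.sub_mulVec, Matrix.one_mulVec, hy, smul_neg]; abel
  have h2 := congrArg
    ((1 - (burau t b : Matrix (Fin 3) (Fin 3) R)).adjugate.mulVec) h
  rw [Matrix.mulVec_mulVec, Matrix.adjugate_mul, Matrix.smul_mulVec, Matrix.one_mulVec,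
    Matrix.mulVec_smul] at h2
  have h3 := congrFun h2 0
  simp only [Pi.smul_apply, smul_eq_mul, Matrix.cons_val_zero, mul_one] at h3
  exact ⟨_, h3⟩

end Burau

/-! ### The Alexander polynomial of a closed 4-braid -/

/-- The element `√t` of `ℤ[t^{1/2}, t^{-1/2}]`, which is modelled as the ring of integral
Laurent polynomials in the variable `T 1 = √t`. -/
noncomputable def sqrtT : (LaurentPolynomial ℤ)ˣ where
  val := LaurentPolynomial.T 1
  inv := LaurentPolynomial.T (-1)
  val_inv := by rw [← LaurentPolynomial.T_add]; simp
  inv_val := by rw [← LaurentPolynomial.T_add]; simp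

/-- The element `t` of `ℤ[t^{1/2}, t^{-1/2}]`. -/
noncomputable def tVar : (LaurentPolynomial ℤ)ˣ := sqrtT ^ 2

/-- The Alexander polynomial of the closure of a 4-braid `b`, as an element of
`ℤ[t^{1/2}, t^{-1/2}]`:
`(-1/√t)^(e_b - 3) * (1 - t)/(1 - t⁴) * det (I₃ - ψ_t(b))`, with `ψ_t` the reduced Burau
representation. The factor `(1 - t)/(1 - t⁴)` is division by `1 + t + t² + t³`, which always
divides the determinant; see `alexanderPolynomial_spec`. -/
noncomputable def alexanderPolynomial (b : BraidGroup 3) : LaurentPolynomial ℤ :=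
  (((-sqrtT⁻¹) ^ (braidExponentSum b - 3) : (LaurentPolynomial ℤ)ˣ) : LaurentPolynomial ℤ) *
    Classical.choose (burau_dvd tVar b)

theorem alexanderPolynomial_spec (b : BraidGroup 3) :
    (1 - (tVar : LaurentPolynomial ℤ) ^ 4) * alexanderPolynomial b =
      (((-sqrtT⁻¹) ^ (braidExponentSum b - 3) : (LaurentPolynomial ℤ)ˣ) : LaurentPolynomial ℤ) *
        ((1 - (tVar : LaurentPolynomial ℤ)) *
          (1 - (burau tVar b : Matrix (Fin 3) (Fin 3) (LaurentPolynomial ℤ))).det) := by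
  rw [Classical.choose_spec (burau_dvd tVar b), alexanderPolynomial]
  ring

/-! ### The signature of a closed braid -/

namespace BraidWord

variable {k : ℕ} (w : BraidWord k)

/-- The sign `±1` of the crossing at position `a` of the word. -/
def crossingSign (a : Fin w.length) : ℤ := if (w.get a).2 then 1 else -1

/-- Seifert's algorithm applied to the closure of the word gives a surface made of `k + 1`
stacked discs and one half-twisted band for each letter, a letter with index `i` joining the
discs `i` and `i + 1`. A basis of its first homology is given by the loops which run up one band
and down the next band between the same two discs: they correspond to the pairs `a < b` of
positions with the same index `i` such that `i` does not occur strictly between `a` and `b`. -/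
abbrev SeifertLoop : Type :=
  {x : Fin w.length × Fin w.length //
    x.1 < x.2 ∧ (w.get x.1).1 = (w.get x.2).1 ∧
      ∀ c, x.1 < c → c < x.2 → (w.get c).1 ≠ (w.get x.1).1}

/-- The index of the generator to which the bands of a loop belong. -/
def SeifertLoop.column {w : BraidWord k} (x : w.SeifertLoop) : Fin k := (w.get x.1.1).1

/-- The Seifert matrix of the closed braid: its entries are the linking numbers `lk (x⁺, y)`,
where `x⁺` is the push-off of the loop `x` in the positive normal direction.

* A loop through two bands with signs `ε` and `ε'` has self-linking `-(ε + ε') / 2`.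
* If `x` and `y` lie in the same column and the last band of `x` is the first band of `y`, then
  `lk (x⁺, y) = 1` and `lk (y⁺, x) = 0` when that band is positive, while
  `lk (x⁺, y) = 0` and `lk (y⁺, x) = -1` when it is negative.
* If `x` lies in column `i` and `y` in column `i + 1`, then `x⁺` and `y` are linked exactly when
  the endpoints of the two loops interleave, and `lk (y⁺, x) = 0`.
* All other linking numbers vanish. -/
def seifertMatrix : Matrix w.SeifertLoop w.SeifertLoop ℤ := fun x y =>
  if x = y then -((w.crossingSign x.1.1 + w.crossingSign x.1.2) / 2)
  else if x.1.2 = y.1.1 then (if w.crossingSign x.1.2 = 1 then 1 else 0)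
  else if y.1.2 = x.1.1 then (if w.crossingSign x.1.1 = 1 then 0 else -1)
  else if (x.column : ℕ) + 1 = y.column then
    (if x.1.1 < y.1.1 ∧ y.1.1 < x.1.2 ∧ x.1.2 < y.1.2 then -1
     else if y.1.1 < x.1.1 ∧ x.1.1 < y.1.2 ∧ y.1.2 < x.1.2 then 1
     else 0)
  else 0

/-- The signature of the closure of a braid word: the number of positive minus the number of
negative eigenvalues of the symmetrized Seifert matrix `V + Vᵀ`. -/
noncomputable def signature : ℤ :=
  let Q : QuadraticForm ℝ (w.SeifertLoop → ℝ) :=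
    ((w.seifertMatrix + w.seifertMatrix.transpose).map (Int.cast : ℤ → ℝ)).toQuadraticForm'
  (sigPos Q : ℤ) - (sigNeg Q : ℤ)

end BraidWord

/-! ### Symmetric and trapezoidal polynomials

A nonzero polynomial is written as `p = ∑_{k=0}^{n} a_k s^(k+r)` with `a_0 ≠ 0` and `a_n ≠ 0`. -/

namespace Polynomial

/-- The number `n` in `p = ∑_{k=0}^{n} a_k s^(k+r)`. -/
def span (p : Polynomial ℤ) : ℕ := p.natDegree - p.natTrailingDegree

/-- The coefficient `a_k` in `p = ∑_{k=0}^{n} a_k s^(k+r)`. -/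
def shiftedCoeff (p : Polynomial ℤ) (k : ℕ) : ℤ := p.coeff (k + p.natTrailingDegree)

/-- `a_k = a_{n-k}` for all `0 ≤ k ≤ n`. -/
def IsSymmetric (p : Polynomial ℤ) : Prop :=
  ∀ k ≤ p.span, p.shiftedCoeff k = p.shiftedCoeff (p.span - k)

/-- `a_0 < ⋯ < a_i = ⋯ = a_j > ⋯ > a_n` for some `0 ≤ i ≤ j ≤ n`. -/
def IsTrapezoidal (p : Polynomial ℤ) : Prop :=
  ∃ i j : ℕ, i ≤ j ∧ j ≤ p.span ∧
    (∀ k < i, p.shiftedCoeff k < p.shiftedCoeff (k + 1)) ∧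
    (∀ k, i ≤ k → k < j → p.shiftedCoeff k = p.shiftedCoeff (k + 1)) ∧
    (∀ k, j ≤ k → k < p.span → p.shiftedCoeff (k + 1) < p.shiftedCoeff k)

/-- `l` is the length of the stable part of `p`: the largest `l` such that
`a_{k₀} = a_{k₀+1} = ⋯ = a_{k₀+l}` for some `k₀`, where `k₀ + l ≤ n`. -/
def IsStableLength (p : Polynomial ℤ) (l : ℕ) : Prop :=
  IsGreatest {l : ℕ | ∃ k₀ : ℕ, k₀ + l ≤ p.span ∧
    ∀ m ≤ l, p.shiftedCoeff (k₀ + m) = p.shiftedCoeff k₀} l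

end Polynomial

/-! ### The two-block alternating 4-braids -/

/-- `[n] = 1 + s + ⋯ + s^(n-1) = (1 - s^n)/(1 - s)`. -/
noncomputable def qInt (n : ℕ) : Polynomial ℤ := ∑ i ∈ Finset.range n, Polynomial.X ^ i

/-- The word `σ₁^{p₁} σ₂^{-q₁} σ₃^{r₁} σ₁^{p₂} σ₂^{-q₂} σ₃^{r₂}`. -/
def twoBlockWord (p₁ q₁ r₁ p₂ q₂ r₂ : ℕ) : BraidWord 3 :=
  List.replicate p₁ (0, true) ++ List.replicate q₁ (1, false) ++ List.replicate r₁ (2, true) ++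
    List.replicate p₂ (0, true) ++ List.replicate q₂ (1, false) ++ List.replicate r₂ (2, true)

/-- `s[q₁][q₂]([p₁][p₂][r₁+r₂] + [r₁][r₂][p₁+p₂]) + [p₁+p₂][q₁+q₂][r₁+r₂]`. -/
noncomputable def twoBlockPolynomial (p₁ q₁ r₁ p₂ q₂ r₂ : ℕ) : Polynomial ℤ :=
  Polynomial.X * qInt q₁ * qInt q₂ *
      (qInt p₁ * qInt p₂ * qInt (r₁ + r₂) + qInt r₁ * qInt r₂ * qInt (p₁ + p₂)) +
    qInt (p₁ + p₂) * qInt (q₁ + q₂) * qInt (r₁ + r₂)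

/-!
The Burau matrix of `σ_i` is `1 - N` with `N ^ 2 = (1 - s) N`, where `s = -t`, so its powers are
`1 - [n] N`, and likewise for its inverse; the determinant is then a polynomial identity in the
`[pᵢ]`, `[qᵢ]`, `[rᵢ]`.

Multiplication by `[m]` preserves symmetric trapezoids, and concentric symmetric trapezoids add:
the plateau of the sum is the shortest of their plateaus. So the polynomial is trapezoidal, and its
plateau is at most as long as that of `[p₁+p₂][q₁+q₂][r₁+r₂]`.

On the loops of one sign, `V + Vᵀ` is up to sign the Gram matrix of linearly independent vectors
(first band minus last band). Hence the signature counts the loops with signs; a column with `n`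
bands carries `n - 1` loops, and `|(q₁+q₂-1) - (p₁+p₂-1) - (r₁+r₂-1)|` bounds that plateau.
-/

open Polynomial

/-! ### Powers of the reduced Burau matrices -/

theorem one_sub_X_mul_qInt (n : ℕ) : (1 - X) * qInt n = 1 - X ^ n :=
  mul_neg_geom_sum X n

theorem qInt_add (m n : ℕ) : qInt (m + n) = qInt m + qInt n - (1 - X) * qInt m * qInt n := by
  have hsplit : qInt (m + n) = qInt m + X ^ m * qInt n := by
    simp only [qInt, Finset.sum_range_add, pow_add, Finset.mul_sum]
  rw [hsplit, one_sub_X_mul_qInt]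
  ring

section CommRing

variable {R : Type*} [CommRing R]

theorem one_sub_mul_aeval_qInt (s : R) (n : ℕ) :
    (1 - s) * aeval s (qInt n) = 1 - s ^ n := by
  simpa only [map_mul, map_sub, map_one, map_pow, aeval_X] using
    congrArg (aeval s) (one_sub_X_mul_qInt n)

theorem aeval_qInt_add (s : R) (m n : ℕ) :
    aeval s (qInt (m + n)) =
      aeval s (qInt m) + aeval s (qInt n) - (1 - s) * aeval s (qInt m) * aeval s (qInt n) := by
  simp only [qInt_add, map_sub, map_add, map_mul, map_one, aeval_X]

/-- The `q`-integer `[-n] = (1 - s⁻ⁿ) / (1 - s)`, written as `-s⁻ⁿ [n]` to avoid division. -/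
noncomputable def negQInt (s : Rˣ) (n : ℕ) : R :=
  -(((s⁻¹ ^ n : Rˣ) : R) * aeval (s : R) (qInt n))

theorem negQInt_add (s : Rˣ) (m n : ℕ) :
    negQInt s (m + n) = negQInt s m + negQInt s n - (1 - s) * negQInt s m * negQInt s n := by
  have hinv (k : ℕ) :
      ((s⁻¹ ^ k : Rˣ) : R) * (1 - (1 - s) * aeval (s : R) (qInt k)) = 1 := by
    rw [one_sub_mul_aeval_qInt, sub_sub_cancel, ← Units.val_pow_eq_pow_val, inv_pow,
      Units.inv_mul]
  simp only [negQInt, aeval_qInt_add, pow_add, Units.val_mul]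
  linear_combination
    -((s⁻¹ ^ m : Rˣ) : R) * aeval (s : R) (qInt m) * hinv n -
      ((s⁻¹ ^ n : Rˣ) : R) * aeval (s : R) (qInt n) * hinv m

theorem aeval_qInt_add_negQInt (s : Rˣ) (n : ℕ) :
    aeval (s : R) (qInt n) + negQInt s n - (1 - s) * aeval (s : R) (qInt n) * negQInt s n = 0 := by
  have hinv : ((s⁻¹ ^ n : Rˣ) : R) * (s : R) ^ n = 1 := by
    rw [← Units.val_pow_eq_pow_val, inv_pow, Units.inv_mul]
  rw [negQInt]
  linear_combination ((s⁻¹ ^ n : Rˣ) : R) * aeval (s : R) (qInt n) *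
    one_sub_mul_aeval_qInt (s : R) n - aeval (s : R) (qInt n) * hinv

section Reflection

variable {A : Type*} [Ring A] [Algebra R A] {N : A}

theorem one_sub_smul_mul_one_sub_smul {c : R} (hN : N * N = c • N) (x y : R) :
    (1 - x • N) * (1 - y • N) = 1 - (x + y - c * x * y) • N := by
  have hxy : x • N * y • N = (c * x * y) • N := by
    rw [smul_mul_smul_comm, hN, smul_smul, mul_comm (x * y), mul_assoc]
  rw [sub_mul, one_mul, mul_sub, mul_one, hxy, sub_smul, add_smul]
  abel

theorem one_sub_pow_eq_one_sub_smul {s : R} (hN : N * N = (1 - s) • N) (n : ℕ) :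
    (1 - N) ^ n = 1 - aeval s (qInt n) • N := by
  induction n with
  | zero => simp [qInt]
  | succ n ih =>
    rw [pow_succ, ih, aeval_qInt_add, show qInt 1 = 1 by simp [qInt], map_one]
    simpa only [one_smul] using one_sub_smul_mul_one_sub_smul hN (aeval s (qInt n)) 1

theorem pow_eq_one_sub_negQInt_smul_of_mul_one_sub_eq_one {s : Rˣ} (hN : N * N = (1 - (s : R)) • N)
    {M : A} (hM : M * (1 - N) = 1) (n : ℕ) : M ^ n = 1 - negQInt s n • N := by
  refine left_inv_eq_right_inv (a := (1 - N) ^ n) ?_ ?_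
  · exact pow_mul_pow_eq_one n hM
  · rw [one_sub_pow_eq_one_sub_smul hN, one_sub_smul_mul_one_sub_smul hN,
      aeval_qInt_add_negQInt, zero_smul, sub_zero]

end Reflection

theorem one_sub_burauMatrix_mul_self (t : Rˣ) (i : Fin 3) :
    (1 - burauMatrix t i) * (1 - burauMatrix t i) =
      (1 - ((-t : Rˣ) : R)) • (1 - burauMatrix t i) := by
  fin_cases i <;> ext a b <;> fin_cases a <;> fin_cases b <;>
    simp [burauMatrix, Matrix.mul_apply, Fin.sum_univ_three, Matrix.one_apply]

theorem burauMatrix_pow (t : Rˣ) (i : Fin 3) (n : ℕ) :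
    burauMatrix t i ^ n = 1 - aeval ((-t : Rˣ) : R) (qInt n) • (1 - burauMatrix t i) := by
  simpa only [sub_sub_cancel] using
    one_sub_pow_eq_one_sub_smul (one_sub_burauMatrix_mul_self t i) n

theorem burauMatrixInv_pow (t : Rˣ) (i : Fin 3) (n : ℕ) :
    burauMatrixInv t i ^ n = 1 - negQInt (-t) n • (1 - burauMatrix t i) :=
  pow_eq_one_sub_negQInt_smul_of_mul_one_sub_eq_one (one_sub_burauMatrix_mul_self t i)
    (by rw [sub_sub_cancel, burauMatrixInv_mul]) n

theorem BraidWord.toBraid_append {k : ℕ} (w w' : BraidWord k) :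
    BraidWord.toBraid (w ++ w') = w.toBraid * w'.toBraid := by
  rw [BraidWord.toBraid, BraidWord.toBraid, BraidWord.toBraid, ← map_mul, FreeGroup.mul_mk]

theorem BraidWord.toBraid_replicate {k : ℕ} (n : ℕ) (u : Fin k × Bool) :
    BraidWord.toBraid (List.replicate n u) = BraidWord.toBraid [u] ^ n := by
  induction n with
  | zero => exact map_one _
  | succ n ih => rw [List.replicate_succ', BraidWord.toBraid_append, ih, pow_succ]

theorem burau_of (t : Rˣ) (i : Fin 3) : burau t (PresentedGroup.of i) = burauGen t i :=
  PresentedGroup.toGroup.of _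

theorem burau_toBraid_replicate_true (t : Rˣ) (i : Fin 3) (n : ℕ) :
    (burau t (BraidWord.toBraid (List.replicate n (i, true))) : Matrix (Fin 3) (Fin 3) R) =
      1 - aeval ((-t : Rˣ) : R) (qInt n) • (1 - burauMatrix t i) := by
  have hgen : burau t (BraidWord.toBraid [(i, true)]) = burauGen t i := burau_of t i
  rw [BraidWord.toBraid_replicate, map_pow, hgen, Units.val_pow_eq_pow_val, ← burauMatrix_pow,
    burauGen]

theorem burau_toBraid_replicate_false (t : Rˣ) (i : Fin 3) (n : ℕ) :
    (burau t (BraidWord.toBraid (List.replicate n (i, false))) : Matrix (Fin 3) (Fin 3) R) =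
      1 - negQInt (-t) n • (1 - burauMatrix t i) := by
  have hgen : burau t (BraidWord.toBraid [(i, false)]) = (burauGen t i)⁻¹ := by
    rw [← burau_of, ← map_inv]
    rfl
  rw [BraidWord.toBraid_replicate, map_pow, hgen, Units.val_pow_eq_pow_val, ← burauMatrixInv_pow,
    burauGen, Units.inv_mk]

theorem prod_one_sub_smul_one_sub_burauMatrix (t : Rˣ) (x y z : R) :
    (1 - x • (1 - burauMatrix t 0)) * (1 - y • (1 - burauMatrix t 1)) *
        (1 - z • (1 - burauMatrix t 2)) =
      !![1 - (1 + t) * x + t * x * y, x * (1 - (1 + t) * y + t * y * z),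
          x * y * (1 - (1 + t) * z);
        t * y, 1 - (1 + t) * y + t * y * z, y * (1 - (1 + t) * z);
        0, t * z, 1 - (1 + t) * z] := by
  ext a b
  fin_cases a <;> fin_cases b <;>
    simp [burauMatrix, Matrix.mul_apply, Fin.sum_univ_three, Matrix.one_apply] <;> ring

theorem burau_toBraid_block (t : Rˣ) (p q r : ℕ) :
    (burau t (BraidWord.toBraid (List.replicate p (0, true) ++ List.replicate q (1, false) ++
        List.replicate r (2, true))) : Matrix (Fin 3) (Fin 3) R) =
      (1 - aeval ((-t : Rˣ) : R) (qInt p) • (1 - burauMatrix t 0)) *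
        (1 - negQInt (-t) q • (1 - burauMatrix t 1)) *
        (1 - aeval ((-t : Rˣ) : R) (qInt r) • (1 - burauMatrix t 2)) := by
  simp only [BraidWord.toBraid_append, map_mul, Units.val_mul, burau_toBraid_replicate_true,
    burau_toBraid_replicate_false]

theorem det_one_sub_prod_one_sub_smul (t : Rˣ) (x₁ y₁ z₁ x₂ y₂ z₂ : R) :
    (1 - (1 - x₁ • (1 - burauMatrix t 0)) * (1 - y₁ • (1 - burauMatrix t 1)) *
      (1 - z₁ • (1 - burauMatrix t 2)) * ((1 - x₂ • (1 - burauMatrix t 0)) *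
      (1 - y₂ • (1 - burauMatrix t 1)) * (1 - z₂ • (1 - burauMatrix t 2)))).det =
      (1 + (t : R) + (t : R) ^ 2 + (t : R) ^ 3) *
        ((x₁ + x₂ - (1 + t) * x₁ * x₂) * (y₁ + y₂ - (1 + t) * y₁ * y₂) *
            (z₁ + z₂ - (1 + t) * z₁ * z₂) +
          t * y₁ * y₂ * (x₁ * x₂ * (z₁ + z₂ - (1 + t) * z₁ * z₂) +
            z₁ * z₂ * (x₁ + x₂ - (1 + t) * x₁ * x₂))) := by
  rw [prod_one_sub_smul_one_sub_burauMatrix, prod_one_sub_smul_one_sub_burauMatrix,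
    Matrix.mul_fin_three, Matrix.one_fin_three, Matrix.det_fin_three]
  simp only [Matrix.sub_apply, Matrix.of_apply, Matrix.cons_val', Matrix.cons_val_zero,
    Matrix.cons_val_one, Matrix.cons_val, Matrix.cons_val_fin_one]
  ring

theorem det_one_sub_burau_twoBlockWord (t : Rˣ) (p₁ q₁ r₁ p₂ q₂ r₂ : ℕ) :
    (1 - (burau t (twoBlockWord p₁ q₁ r₁ p₂ q₂ r₂).toBraid : Matrix (Fin 3) (Fin 3) R)).det =
      (1 + (t : R) + (t : R) ^ 2 + (t : R) ^ 3) *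
        (((-(-t)⁻¹ ^ (q₁ + q₂) : Rˣ) : R) *
          aeval (-(t : R)) (twoBlockPolynomial p₁ q₁ r₁ p₂ q₂ r₂)) := by
  have hs : 1 + (t : R) = 1 - ((-t : Rˣ) : R) := by rw [Units.val_neg, sub_neg_eq_add]
  have hblocks : twoBlockWord p₁ q₁ r₁ p₂ q₂ r₂ =
      (List.replicate p₁ (0, true) ++ List.replicate q₁ (1, false) ++
        List.replicate r₁ (2, true)) ++
      (List.replicate p₂ (0, true) ++ List.replicate q₂ (1, false) ++
        List.replicate r₂ (2, true)) := by
    simp only [twoBlockWord, List.append_assoc]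
  rw [hblocks, BraidWord.toBraid_append, map_mul, Units.val_mul, burau_toBraid_block,
    burau_toBraid_block, det_one_sub_prod_one_sub_smul, hs, ← aeval_qInt_add,
    ← aeval_qInt_add, ← negQInt_add]
  simp only [negQInt, twoBlockPolynomial, map_add, map_mul, aeval_X, Units.val_neg, pow_add,
    Units.val_mul]
  ring

end CommRing

theorem one_add_tVar_add_sq_add_cube_ne_zero :
    1 + (tVar : LaurentPolynomial ℤ) + (tVar : LaurentPolynomial ℤ) ^ 2 +
      (tVar : LaurentPolynomial ℤ) ^ 3 ≠ 0 := by
  intro h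
  have h_eval := congrArg (LaurentPolynomial.eval₂ (RingHom.id ℤ) 1) h
  simp [tVar, sqrtT, LaurentPolynomial.T_pow] at h_eval

theorem associated_alexanderPolynomial_of_det_eq {b : BraidGroup 3} {p : LaurentPolynomial ℤ}
    (h : (1 - (burau tVar b : Matrix (Fin 3) (Fin 3) (LaurentPolynomial ℤ))).det =
      (1 + (tVar : LaurentPolynomial ℤ) + (tVar : LaurentPolynomial ℤ) ^ 2 +
        (tVar : LaurentPolynomial ℤ) ^ 3) * p) :
    Associated (alexanderPolynomial b) p := by
  have hp : Classical.choose (burau_dvd tVar b) = p :=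
    mul_left_cancel₀ one_add_tVar_add_sq_add_cube_ne_zero
      ((Classical.choose_spec (burau_dvd tVar b)).symm.trans h)
  rw [alexanderPolynomial, hp]
  exact associated_unit_mul_left _ _ (Units.isUnit _)

theorem associated_alexanderPolynomial_twoBlockWord (p₁ q₁ r₁ p₂ q₂ r₂ : ℕ) :
    Associated (alexanderPolynomial (twoBlockWord p₁ q₁ r₁ p₂ q₂ r₂).toBraid)
      (aeval (-(tVar : LaurentPolynomial ℤ)) (twoBlockPolynomial p₁ q₁ r₁ p₂ q₂ r₂)) :=
  (associated_alexanderPolynomial_of_det_eq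
    (det_one_sub_burau_twoBlockWord tVar p₁ q₁ r₁ p₂ q₂ r₂)).trans
    (associated_unit_mul_left _ _ (Units.isUnit _))

/-! ### Symmetric trapezoidal sequences -/

theorem sum_range_sub_eq_add_sub {M : Type*} [AddCommGroup M] (f : ℤ → M) (m : ℕ) (k : ℤ) :
    ∑ j ∈ Finset.range m, f (k - j) =
      ∑ j ∈ Finset.range m, f (k - 1 - j) + (f k - f (k - m)) := by
  have hhead := Finset.sum_range_succ' (fun j : ℕ => f (k - j)) m
  rw [Finset.sum_range_succ] at hhead
  simp only [Nat.cast_add, Nat.cast_one, Nat.cast_zero, sub_zero, sub_add_eq_sub_sub_swap] at hhead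
  rw [← add_sub_assoc, ← hhead, add_sub_cancel_right]

/-- The sequence `f` is supported on `{0, …, c}`, symmetric about `c / 2`, strictly increasing on
`{-1, 0, …, i}` and constant on `{i, …, c - i}`. Sequences are indexed by `ℤ` so that they can be
translated and reflected freely. -/
structure IsSymmTrapezoid {M : Type*} [Preorder M] [Zero M] (f : ℤ → M) (c i : ℤ) : Prop where
  nonneg : 0 ≤ i
  two_mul_le : 2 * i ≤ c
  zero : ∀ k < 0, f k = 0
  symm : ∀ k, f (c - k) = f k
  rise : ∀ k, 0 ≤ k → k ≤ i → f (k - 1) < f k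
  flat : ∀ k, i < k → 2 * k ≤ c + 1 → f (k - 1) = f k

namespace IsSymmTrapezoid

section Preorder

variable {M : Type*} [Preorder M] [Zero M] {f : ℤ → M} {c i : ℤ}

theorem step_le (h : IsSymmTrapezoid f c i) {k : ℤ} (hk : 2 * k ≤ c + 1) : f (k - 1) ≤ f k := by
  rcases lt_or_ge k 0 with h_neg | h_nonneg
  · rw [h.zero k h_neg, h.zero (k - 1) (by lia)]
  · rcases le_or_gt k i with hki | hik
    · exact (h.rise k h_nonneg hki).le
    · exact (h.flat k hik hk).le

theorem mono (h : IsSymmTrapezoid f c i) {a b : ℤ} (hab : a ≤ b) (hb : 2 * b ≤ c + 1) :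
    f a ≤ f b := by
  induction b, hab using Int.leInduction with
  | base => exact le_rfl
  | succ b _ ih =>
    have hstep := h.step_le hb
    rw [add_sub_cancel_right] at hstep
    exact (ih (by lia)).trans hstep

theorem eq_zero_of_lt (h : IsSymmTrapezoid f c i) {k : ℤ} (hk : c < k) : f k = 0 := by
  rw [← h.symm, h.zero _ (by lia)]

theorem eq_plateau (h : IsSymmTrapezoid f c i) {k : ℤ} (hik : i ≤ k) (hki : k ≤ c - i) :
    f k = f i := by
  wlog hk : 2 * k ≤ c generalizing k
  · rw [← h.symm]
    exact this (by lia) (by lia) (by lia)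
  induction k, hik using Int.leInduction with
  | base => rfl
  | succ k hik ih =>
    have hstep := h.flat (k + 1) (by lia) (by lia)
    rw [add_sub_cancel_right] at hstep
    exact hstep.symm.trans (ih (by lia) (by lia))

theorem lt_of_add_lt (h : IsSymmTrapezoid f c i) {a b : ℤ} (hai : a < i) (hab : a < b)
    (hadd : a + b < c) (hb : 0 ≤ b) (hbc : b ≤ c) : f a < f b := by
  wlog hbc' : 2 * b ≤ c generalizing b
  · rw [← h.symm b]
    exact this (by lia) (by lia) (by lia) (by lia) (by lia)
  have h_nonneg := h.nonneg
  calc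
    f a ≤ f (max a (-1)) := h.mono (le_max_left _ _) (by lia)
    _ < f (max a (-1) + 1) := by
      simpa only [add_sub_cancel_right] using h.rise (max a (-1) + 1) (by lia) (by lia)
    _ ≤ f b := h.mono (by lia) (by lia)

theorem pos (h : IsSymmTrapezoid f c i) {k : ℤ} (hk : 0 ≤ k) (hkc : k ≤ c) : 0 < f k := by
  have h_nonneg := h.nonneg
  rw [← h.zero (-1) (by lia)]
  exact h.lt_of_add_lt (by lia) (by lia) (by lia) hk hkc

end Preorder

section OrderedAddCommGroup

variable {M : Type*} [AddCommGroup M] [PartialOrder M] [IsOrderedAddMonoid M]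
  {f g : ℤ → M} {c i i' : ℤ}

theorem sum_range_sub (h : IsSymmTrapezoid f c i) {m : ℕ} (hm : 0 < m) :
    IsSymmTrapezoid (fun k => ∑ j ∈ Finset.range m, f (k - j)) (c + m - 1)
      (min c (min (i + m - 1) ((c + m - 1) / 2))) := by
  have h_two := h.two_mul_le
  have h_nonneg := h.nonneg
  refine ⟨by lia, by lia, fun k hk => ?zero, fun k => ?symm, fun k hk0 hk => ?rise,
    fun k hk hkc => ?flat⟩
  case zero => exact Finset.sum_eq_zero fun j _ => h.zero _ (by lia)
  case symm =>
    rw [← Finset.sum_range_reflect]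
    refine Finset.sum_congr rfl fun j hj => ?_
    rw [Finset.mem_range] at hj
    rw [← h.symm]
    congr 1
    lia
  case rise =>
    rw [sum_range_sub_eq_add_sub f m k, lt_add_iff_pos_right, sub_pos]
    exact h.lt_of_add_lt (by lia) (by lia) (by lia) hk0 (by lia)
  case flat =>
    have hends : f k = f (k - m) := by
      rcases lt_or_ge c k with hck | hkc'
      · rw [h.eq_zero_of_lt hck, h.zero _ (by lia)]
      rcases eq_or_ne (2 * k) (c + m) with hmid | hmid
      · rw [← h.symm k, show c - k = k - m by lia]
      · rw [h.eq_plateau (k := k) (by lia) (by lia),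
          h.eq_plateau (k := k - m) (by lia) (by lia)]
    rw [sum_range_sub_eq_add_sub f m k, hends, sub_self, add_zero]

theorem add_shift (hf : IsSymmTrapezoid f c i) {d : ℤ} (hd : 0 ≤ d) (hdi : d ≤ i + 1)
    (hg : IsSymmTrapezoid g (c - 2 * d) i') :
    IsSymmTrapezoid (fun k => f k + g (k - d)) c (max i (i' + d)) := by
  have hf_two := hf.two_mul_le
  have hg_two := hg.two_mul_le
  have hf_nonneg := hf.nonneg
  refine ⟨by lia, by lia, fun k hk => ?zero, fun k => ?symm, fun k hk0 hk => ?rise,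
    fun k hk hkc => ?flat⟩
  case zero => rw [hf.zero k hk, hg.zero (k - d) (by lia), add_zero]
  case symm => rw [hf.symm, ← hg.symm (k - d), show c - k - d = c - 2 * d - (k - d) by ring]
  case rise =>
    have hf_le := hf.step_le (k := k) (by lia)
    have hg_le := hg.step_le (k := k - d) (by lia)
    rw [sub_right_comm]
    rcases le_or_gt k i with hki | hik
    · exact add_lt_add_of_lt_of_le (hf.rise k hk0 hki) hg_le
    · exact add_lt_add_of_le_of_lt hf_le (hg.rise (k - d) (by lia) (by lia))
  case flat => rw [sub_right_comm, hf.flat k (by lia) hkc, hg.flat (k - d) (by lia) (by lia)]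

end OrderedAddCommGroup

end IsSymmTrapezoid

/-! ### Polynomials with symmetric trapezoidal coefficients -/

section CoeffInt

variable {R : Type*} [Semiring R]

/-- The coefficient sequence of a polynomial, extended by zero to negative indices, so that
multiplication by `X ^ n` becomes a translation by `n`. -/
def coeffInt (p : R[X]) (k : ℤ) : R := if 0 ≤ k then p.coeff k.toNat else 0

theorem coeffInt_natCast (p : R[X]) (k : ℕ) : coeffInt p k = p.coeff k := by
  simp [coeffInt]

theorem coeffInt_add (p q : R[X]) (k : ℤ) : coeffInt (p + q) k = coeffInt p k + coeffInt q k := by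
  by_cases h : 0 ≤ k <;> simp [coeffInt, h]

theorem coeffInt_sum {ι : Type*} (s : Finset ι) (p : ι → R[X]) (k : ℤ) :
    coeffInt (∑ j ∈ s, p j) k = ∑ j ∈ s, coeffInt (p j) k := by
  by_cases h : 0 ≤ k <;> simp [coeffInt, h]

theorem coeffInt_X_pow_mul (p : R[X]) (n : ℕ) (k : ℤ) :
    coeffInt (X ^ n * p) k = coeffInt p (k - n) := by
  rcases lt_or_ge k 0 with hk | hk
  · rw [coeffInt, coeffInt, if_neg (by lia), if_neg (by lia)]
  · lift k to ℕ using hk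
    rcases lt_or_ge k n with hkn | hnk
    · rw [coeffInt_natCast, coeff_X_pow_mul', if_neg (by lia), coeffInt, if_neg (by lia)]
    · rw [coeffInt_natCast, coeff_X_pow_mul', if_pos hnk, ← Nat.cast_sub hnk, coeffInt_natCast]

end CoeffInt

theorem coeffInt_qInt_mul (m : ℕ) (p : ℤ[X]) (k : ℤ) :
    coeffInt (qInt m * p) k = ∑ j ∈ Finset.range m, coeffInt p (k - j) := by
  simp only [qInt, Finset.sum_mul, coeffInt_sum, coeffInt_X_pow_mul]

namespace IsSymmTrapezoid

theorem coeffInt_one : IsSymmTrapezoid (coeffInt (1 : ℤ[X])) 0 0 := by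
  have hcoeff (k : ℤ) : coeffInt (1 : ℤ[X]) k = if k = 0 then 1 else 0 := by
    rw [coeffInt, coeff_one]
    split_ifs <;> first | rfl | lia
  refine ⟨le_rfl, le_rfl, fun k hk => ?_, fun k => ?_, fun k hk0 hk => ?_, fun k hk hkc => by lia⟩
  · rw [hcoeff, if_neg hk.ne]
  · simp [hcoeff]
  · obtain rfl : k = 0 := le_antisymm hk hk0
    simp [hcoeff]

variable {p q : ℤ[X]} {c i i' : ℤ}

theorem qInt_mul (h : IsSymmTrapezoid (coeffInt p) c i) {m : ℕ} (hm : 0 < m) :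
    IsSymmTrapezoid (coeffInt (qInt m * p)) (c + m - 1)
      (min c (min (i + m - 1) ((c + m - 1) / 2))) := by
  simpa only [← coeffInt_qInt_mul] using h.sum_range_sub hm

theorem add_X_pow_mul (hp : IsSymmTrapezoid (coeffInt p) c i) {d : ℕ} (hd : d ≤ i + 1)
    (hq : IsSymmTrapezoid (coeffInt q) (c - 2 * d) i') :
    IsSymmTrapezoid (coeffInt (p + X ^ d * q)) c (max i (i' + d)) := by
  simpa only [← coeffInt_X_pow_mul, ← coeffInt_add] using hp.add_shift d.cast_nonneg hd hq

theorem natTrailingDegree_eq_zero (h : IsSymmTrapezoid (coeffInt p) c i) :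
    p.natTrailingDegree = 0 := by
  have hpos : 0 < coeffInt p (0 : ℕ) := h.pos le_rfl (by grind [h.nonneg, h.two_mul_le])
  rw [coeffInt_natCast] at hpos
  exact Polynomial.natTrailingDegree_eq_zero.2 (Or.inr hpos.ne')

theorem natDegree_eq (h : IsSymmTrapezoid (coeffInt p) c i) : (p.natDegree : ℤ) = c := by
  have hc : 0 ≤ c := by grind [h.nonneg, h.two_mul_le]
  lift c to ℕ using hc
  rw [Nat.cast_inj]
  refine natDegree_eq_of_le_of_coeff_ne_zero (natDegree_le_iff_coeff_eq_zero.2 fun k hk => ?_) ?_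
  · rw [← coeffInt_natCast, h.eq_zero_of_lt (by exact_mod_cast hk)]
  · rw [← coeffInt_natCast]
    exact (h.pos c.cast_nonneg le_rfl).ne'

theorem span_eq (h : IsSymmTrapezoid (coeffInt p) c i) : (p.span : ℤ) = c := by
  rw [Polynomial.span, h.natTrailingDegree_eq_zero, Nat.sub_zero, h.natDegree_eq]

theorem shiftedCoeff_eq (h : IsSymmTrapezoid (coeffInt p) c i) (k : ℕ) :
    p.shiftedCoeff k = coeffInt p k := by
  rw [shiftedCoeff, h.natTrailingDegree_eq_zero, add_zero, coeffInt_natCast]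

theorem isSymmetric (h : IsSymmTrapezoid (coeffInt p) c i) : p.IsSymmetric := by
  intro k hk
  rw [h.shiftedCoeff_eq, h.shiftedCoeff_eq, Nat.cast_sub hk, h.span_eq, h.symm]

theorem shiftedCoeff_ne_zero (h : IsSymmTrapezoid (coeffInt p) c i) {k : ℕ} (hk : k ≤ p.span) :
    p.shiftedCoeff k ≠ 0 := by
  rw [h.shiftedCoeff_eq]
  exact (h.pos k.cast_nonneg (by grind [h.span_eq])).ne'

theorem shiftedCoeff_lt_succ (h : IsSymmTrapezoid (coeffInt p) c i) {k : ℕ} (hk : k < i) :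
    p.shiftedCoeff k < p.shiftedCoeff (k + 1) := by
  have h_two := h.two_mul_le
  rw [h.shiftedCoeff_eq, h.shiftedCoeff_eq]
  exact h.lt_of_add_lt hk (by lia) (by lia) (by lia) (by lia)

theorem shiftedCoeff_succ_lt (h : IsSymmTrapezoid (coeffInt p) c i) {k : ℕ} (hk : c - i ≤ k)
    (hkc : k < c) : p.shiftedCoeff (k + 1) < p.shiftedCoeff k := by
  have h_two := h.two_mul_le
  rw [h.shiftedCoeff_eq, h.shiftedCoeff_eq, ← h.symm]
  exact h.lt_of_add_lt (by lia) (by lia) (by lia) (by lia) (by lia)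

theorem shiftedCoeff_eq_succ (h : IsSymmTrapezoid (coeffInt p) c i) {k : ℕ} (hk : i ≤ k)
    (hkc : k < c - i) : p.shiftedCoeff k = p.shiftedCoeff (k + 1) := by
  rw [h.shiftedCoeff_eq, h.shiftedCoeff_eq, h.eq_plateau hk hkc.le,
    h.eq_plateau (k := (k + 1 : ℕ)) (by lia) (by lia)]

theorem isTrapezoidal (h : IsSymmTrapezoid (coeffInt p) c i) : p.IsTrapezoidal := by
  have h_span := h.span_eq
  have h_two := h.two_mul_le
  have h_nonneg := h.nonneg
  exact ⟨i.toNat, (c - i).toNat, by lia, by lia, fun k hk => h.shiftedCoeff_lt_succ (by lia),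
    fun k hik hkc => h.shiftedCoeff_eq_succ (by lia) (by lia),
    fun k hik hkc => h.shiftedCoeff_succ_lt (by lia) (by lia)⟩

theorem isStableLength (h : IsSymmTrapezoid (coeffInt p) c i) :
    p.IsStableLength (c - 2 * i).toNat := by
  have h_span := h.span_eq
  have h_two := h.two_mul_le
  have h_nonneg := h.nonneg
  constructor
  · refine ⟨i.toNat, by lia, fun m hm => ?_⟩
    rw [h.shiftedCoeff_eq, h.shiftedCoeff_eq, Int.toNat_of_nonneg h_nonneg,
      h.eq_plateau (by lia) (by lia)]
  · rintro l ⟨k₀, hk₀, hl⟩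
    by_contra! hlt
    rcases lt_or_ge (k₀ : ℤ) i with hki | hik
    · exact (h.shiftedCoeff_lt_succ hki).ne (hl 1 (by lia)).symm
    · obtain ⟨m, rfl⟩ : ∃ m, l = m + 1 := Nat.exists_eq_add_one.2 (by lia)
      exact (h.shiftedCoeff_succ_lt (k := k₀ + m) (by lia) (by lia)).ne
        ((hl (m + 1) le_rfl).trans (hl m (by lia)).symm)

end IsSymmTrapezoid

theorem exists_isSymmTrapezoid_prod_qInt {l : List ℕ} (hl : ∀ m ∈ l, 0 < m) :
    ∃ i, IsSymmTrapezoid (coeffInt (l.map qInt).prod) (l.map fun m : ℕ => (m : ℤ) - 1).sum i := by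
  induction l with
  | nil => exact ⟨0, IsSymmTrapezoid.coeffInt_one⟩
  | cons m l ih =>
    obtain ⟨hm, hl'⟩ := List.forall_mem_cons.1 hl
    obtain ⟨i, hi⟩ := ih hl'
    have hmul := hi.qInt_mul hm
    rw [add_sub_assoc, add_comm] at hmul
    rw [List.map_cons, List.prod_cons, List.map_cons, List.sum_cons]
    exact ⟨_, hmul⟩

theorem exists_isSymmTrapezoid_qInt_mul_qInt_mul_qInt {l m n : ℕ} (hl : 0 < l) (hm : 0 < m)
    (hn : 0 < n) :
    ∃ i, IsSymmTrapezoid (coeffInt (qInt l * qInt m * qInt n)) (l + m + n - 3) i ∧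
      l + m + n - 3 - 2 * i ≤ |(m : ℤ) - 1 - (l - 1 + (n - 1))| := by
  have hprod := ((IsSymmTrapezoid.coeffInt_one.qInt_mul hn).qInt_mul hm).qInt_mul hl
  rw [mul_one, ← mul_assoc] at hprod
  refine ⟨_, by convert hprod using 1; ring, ?_⟩
  rw [le_abs]
  lia

theorem exists_isSymmTrapezoid_twoBlockPolynomial {p₁ q₁ r₁ p₂ q₂ r₂ : ℕ} (hp₁ : 0 < p₁)
    (hq₁ : 0 < q₁) (hr₁ : 0 < r₁) (hp₂ : 0 < p₂) (hq₂ : 0 < q₂) (hr₂ : 0 < r₂) :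
    ∃ c i, IsSymmTrapezoid (coeffInt (twoBlockPolynomial p₁ q₁ r₁ p₂ q₂ r₂)) c i ∧
      c - 2 * i ≤ |((q₁ + q₂ : ℕ) : ℤ) - 1 -
        (((p₁ + p₂ : ℕ) : ℤ) - 1 + (((r₁ + r₂ : ℕ) : ℤ) - 1))| := by
  obtain ⟨i, hi, hi_le⟩ := exists_isSymmTrapezoid_qInt_mul_qInt_mul_qInt
    (Nat.add_pos_left hp₁ p₂) (Nat.add_pos_left hq₁ q₂) (Nat.add_pos_left hr₁ r₂)
  obtain ⟨j, hj⟩ := exists_isSymmTrapezoid_prod_qInt (l := [q₁, q₂, p₁, p₂, r₁ + r₂])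
    (by grind)
  obtain ⟨j', hj'⟩ := exists_isSymmTrapezoid_prod_qInt (l := [q₁, q₂, r₁, r₂, p₁ + p₂])
    (by grind)
  have hpoly : twoBlockPolynomial p₁ q₁ r₁ p₂ q₂ r₂ =
      qInt (p₁ + p₂) * qInt (q₁ + q₂) * qInt (r₁ + r₂) + X ^ 1 *
        (([q₁, q₂, p₁, p₂, r₁ + r₂].map qInt).prod + X ^ 0 *
          ([q₁, q₂, r₁, r₂, p₁ + p₂].map qInt).prod) := by
    simp only [twoBlockPolynomial, List.map_cons, List.map_nil, List.prod_cons, List.prod_nil]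
    ring
  have hinner := hj.add_X_pow_mul (d := 0) (i' := j') (by grind [hj.nonneg]) (by
    convert hj' using 1
    simp only [List.map_cons, List.map_nil, List.sum_cons, List.sum_nil]
    push_cast
    ring)
  have houter := hi.add_X_pow_mul (d := 1) (i' := max j (j' + (0 : ℕ))) (by grind [hi.nonneg]) (by
    convert hinner using 1
    simp only [List.map_cons, List.map_nil, List.sum_cons, List.sum_nil]
    push_cast
    ring)
  exact ⟨_, _, hpoly ▸ houter, by lia⟩

/-! ### Signatures of alternating closed braids -/

theorem sigPos_eq_ncard_and_sigNeg_eq_ncard_compl {𝕜 ι : Type*} [Field 𝕜] [LinearOrder 𝕜]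
    [IsStrictOrderedRing 𝕜] [Finite ι] {Q : QuadraticForm 𝕜 (ι → 𝕜)} {s : Set ι}
    (hpos : ∀ v ≠ 0, (∀ i ∉ s, v i = 0) → 0 < Q v)
    (hneg : ∀ v ≠ 0, (∀ i ∈ s, v i = 0) → Q v < 0) :
    sigPos Q = s.ncard ∧ sigNeg Q = sᶜ.ncard := by
  have := Fintype.ofFinite ι
  have hp : s.ncard ≤ sigPos Q := by
    rw [← Pi.dim_spanSubset (R := 𝕜)]
    exact le_sigPos_of_posDef _ fun v hv =>
      hpos v.1 (by simpa using hv) (Pi.mem_spanSubset_iff.mp v.2)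
  have hn : sᶜ.ncard ≤ sigNeg Q := by
    rw [← Pi.dim_spanSubset (R := 𝕜)]
    refine le_sigNeg_of_negDef _ fun v hv => neg_pos.mpr ?_
    exact hneg v.1 (by simpa using hv) fun i hi =>
      Pi.mem_spanSubset_iff.mp v.2 i (Set.notMem_compl_iff.mpr hi)
  have hsum := QuadraticForm.sigPos_add_sigNeg_add_radical (Q := Q)
  rw [Module.finrank_fintype_fun_eq_card, ← Nat.card_eq_fintype_card,
    ← Set.ncard_add_ncard_compl s] at hsum
  lia

namespace BraidWord

variable {k : ℕ} {w : BraidWord k}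

namespace SeifertLoop

theorem eq_of_fst_eq {x y : w.SeifertLoop} (h : x.1.1 = y.1.1) : x = y := by
  obtain ⟨⟨a, b⟩, hab, hc, hn⟩ := x
  obtain ⟨⟨a', b'⟩, hab', hc', hn'⟩ := y
  obtain rfl : a = a' := h
  rcases lt_trichotomy b b' with hb | rfl | hb
  · exact absurd hc.symm (hn' b hab hb)
  · rfl
  · exact absurd hc'.symm (hn b' hab' hb)

theorem eq_of_snd_eq {x y : w.SeifertLoop} (h : x.1.2 = y.1.2) : x = y := by
  obtain ⟨⟨a, b⟩, hab, hc, hn⟩ := x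
  obtain ⟨⟨a', b'⟩, hab', hc', hn'⟩ := y
  obtain rfl : b = b' := h
  rcases lt_trichotomy a a' with ha | rfl | ha
  · exact absurd (hc'.trans hc.symm) (hn a' ha hab')
  · rfl
  · exact absurd (hc.trans hc'.symm) (hn' a ha hab)

/-- The first band of a loop minus its last band, in the free module on the bands. -/
def bandBoundary (R : Type*) [Ring R] (x : w.SeifertLoop) : Fin w.length → R :=
  Pi.single x.1.1 1 - Pi.single x.1.2 1

theorem bandBoundary_dotProduct_bandBoundary (R : Type*) [Ring R] (x y : w.SeifertLoop) :
    x.bandBoundary R ⬝ᵥ y.bandBoundary R =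
      (if x.1.1 = y.1.1 then 1 else 0) - (if x.1.1 = y.1.2 then 1 else 0) -
        (if x.1.2 = y.1.1 then 1 else 0) + (if x.1.2 = y.1.2 then 1 else 0) := by
  simp only [bandBoundary, sub_dotProduct, single_one_dotProduct, Pi.sub_apply, Pi.single_apply]
  abel

theorem linearIndependent_bandBoundary (R : Type*) [Ring R] :
    LinearIndependent R fun x : w.SeifertLoop => x.bandBoundary R := by
  rw [Fintype.linearIndependent_iff]
  intro v hv x
  generalize ha : x.1.1 = a
  induction a using WellFoundedLT.induction generalizing x with
  | _ a ih =>
    have hsum : ∑ y, v y * y.bandBoundary R a = 0 := by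
      simpa only [Finset.sum_apply, Pi.smul_apply, smul_eq_mul, Pi.zero_apply] using congrFun hv a
    rw [Finset.sum_eq_single x ?_ (by simp)] at hsum
    · simpa [bandBoundary, ← ha, x.2.1.ne] using hsum
    · intro y _ hyx
      have hfst : a ≠ y.1.1 := fun h => hyx (eq_of_fst_eq (h.symm.trans ha.symm))
      by_cases hsnd : a = y.1.2
      · rw [ih y.1.1 (hsnd ▸ y.2.1) y rfl, zero_mul]
      · simp [bandBoundary, hfst, hsnd]

end SeifertLoop

/-- Every crossing in column `i` of `w` has sign `ε i`, and adjacent columns have opposite signs,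
so the diagram of the closed braid is alternating. -/
structure IsAlternatingWith (w : BraidWord k) (ε : Fin k → ℤˣ) : Prop where
  crossingSign_eq (a : Fin w.length) : w.crossingSign a = ε (w.get a).1
  ne_of_succ_eq {i j : Fin k} (hij : (i : ℕ) + 1 = j) : ε i ≠ ε j

/-- The quadratic form of the symmetrized Seifert matrix; its signature is `w.signature`. -/
noncomputable def seifertForm (w : BraidWord k) : QuadraticForm ℝ (w.SeifertLoop → ℝ) :=
  ((w.seifertMatrix + w.seifertMatrix.transpose).map (Int.cast : ℤ → ℝ)).toQuadraticForm'

theorem seifertForm_apply (v : w.SeifertLoop → ℝ) :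
    w.seifertForm v =
      ∑ x, ∑ y, v x * v y * ((w.seifertMatrix x y + w.seifertMatrix y x : ℤ) : ℝ) := by
  simp only [seifertForm, Matrix.toQuadraticForm', LinearMap.BilinMap.toQuadraticMap_apply,
    Matrix.toLinearMap₂'_apply', dotProduct, Matrix.mulVec, Finset.mul_sum, Matrix.map_apply,
    Matrix.add_apply, Matrix.transpose_apply]
  exact Finset.sum_congr rfl fun x _ => Finset.sum_congr rfl fun y _ => by ring

namespace IsAlternatingWith

variable {ε : Fin k → ℤˣ}

theorem seifertMatrix_apply (h : w.IsAlternatingWith ε) {x y : w.SeifertLoop}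
    (hxy : ε x.column = ε y.column) :
    w.seifertMatrix x y = if x = y then -(ε x.column : ℤ)
      else if x.1.2 = y.1.1 then (if ε x.column = 1 then 1 else 0)
      else if y.1.2 = x.1.1 then (if ε x.column = 1 then 0 else -1)
      else 0 := by
  have hfst : w.crossingSign x.1.1 = ε x.column := h.crossingSign_eq _
  have hsnd : w.crossingSign x.1.2 = ε x.column := by
    rw [h.crossingSign_eq, SeifertLoop.column, x.2.2.1]
  have hcol : (x.column : ℕ) + 1 ≠ y.column := fun e => h.ne_of_succ_eq e hxy
  simp only [seifertMatrix, hfst, hsnd, if_neg hcol, ← two_mul, Units.val_eq_one,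
    Int.mul_ediv_cancel_left _ (two_ne_zero (α := ℤ))]

theorem seifertMatrix_add_transpose_apply (h : w.IsAlternatingWith ε) (R : Type*) [Ring R]
    {x y : w.SeifertLoop} (hxy : ε x.column = ε y.column) :
    ((w.seifertMatrix x y + w.seifertMatrix y x : ℤ) : R) =
      -((ε x.column : ℤ) : R) * (x.bandBoundary R ⬝ᵥ y.bandBoundary R) := by
  have hfst : x.1.1 = y.1.1 ↔ x = y := ⟨SeifertLoop.eq_of_fst_eq, fun e => e ▸ rfl⟩
  have hsnd : x.1.2 = y.1.2 ↔ x = y := ⟨SeifertLoop.eq_of_snd_eq, fun e => e ▸ rfl⟩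
  rw [h.seifertMatrix_apply hxy, h.seifertMatrix_apply hxy.symm, ← hxy,
    SeifertLoop.bandBoundary_dotProduct_bandBoundary]
  simp only [hfst, hsnd, eq_comm (a := y) (b := x), eq_comm (a := x.1.1) (b := y.1.2)]
  have hx := x.2.1
  have hy := y.2.1
  rcases eq_or_ne x y with rfl | hne
  · simp only [hx.ne', if_true, if_false]
    push_cast
    noncomm_ring
  by_cases hnext : x.1.2 = y.1.1
  · have hprev : y.1.2 ≠ x.1.1 := fun e => (hx.trans_eq hnext).not_gt (hy.trans_eq e)
    rcases Int.units_eq_one_or (ε x.column) with hε | hε <;> simp [hne, hnext, hprev, hε]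
  by_cases hprev : y.1.2 = x.1.1
  · rcases Int.units_eq_one_or (ε x.column) with hε | hε <;> simp [hne, hnext, hprev, hε]
  · simp [hne, hnext, hprev]

/-- On each sign class of loops the symmetrized Seifert matrix is, up to sign, a Gram matrix. -/
theorem seifertForm_eq (h : w.IsAlternatingWith ε) {e : ℤˣ} {v : w.SeifertLoop → ℝ}
    (hv : ∀ x : w.SeifertLoop, ε x.column ≠ e → v x = 0) :
    w.seifertForm v = -((e : ℤ) : ℝ) *
      ((∑ x, v x • x.bandBoundary ℝ) ⬝ᵥ ∑ x, v x • x.bandBoundary ℝ) := by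
  have hterm (x y : w.SeifertLoop) :
      v x * v y * ((w.seifertMatrix x y + w.seifertMatrix y x : ℤ) : ℝ) =
        -((e : ℤ) : ℝ) * (v x * (v y * (x.bandBoundary ℝ ⬝ᵥ y.bandBoundary ℝ))) := by
    by_cases hx : ε x.column = e
    · by_cases hy : ε y.column = e
      · rw [h.seifertMatrix_add_transpose_apply ℝ (hx.trans hy.symm), hx]
        ring
      · simp [hv y hy]
    · simp [hv x hx]
  simp only [sum_dotProduct, smul_dotProduct]
  simp only [seifertForm_apply, hterm, ← Finset.mul_sum, dotProduct_sum, dotProduct_smul,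
    smul_eq_mul]

theorem neg_mul_seifertForm_pos (h : w.IsAlternatingWith ε) {e : ℤˣ} {v : w.SeifertLoop → ℝ}
    (hv : ∀ x : w.SeifertLoop, ε x.column ≠ e → v x = 0) (hv0 : v ≠ 0) :
    0 < -((e : ℤ) : ℝ) * w.seifertForm v := by
  have hb : ∑ x, v x • x.bandBoundary ℝ ≠ 0 := fun h0 => hv0 <| funext <|
    Fintype.linearIndependent_iff.mp (SeifertLoop.linearIndependent_bandBoundary ℝ) v h0
  have he : ((e : ℤ) : ℝ) * ((e : ℤ) : ℝ) = 1 := mod_cast Int.units_coe_mul_self e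
  rw [h.seifertForm_eq hv, ← mul_assoc, neg_mul_neg, he, one_mul]
  simpa only [star_trivial] using Matrix.dotProduct_self_star_pos_iff.mpr hb

theorem signature_eq_neg_sum (h : w.IsAlternatingWith ε) :
    w.signature = -∑ x : w.SeifertLoop, (ε x.column : ℤ) := by
  obtain ⟨hpos, hneg⟩ := sigPos_eq_ncard_and_sigNeg_eq_ncard_compl (Q := w.seifertForm)
    (s := {x | ε x.column = -1})
    (fun v hv0 hv => by simpa using h.neg_mul_seifertForm_pos hv hv0)
    (fun v hv0 hv => by
      have hv1 : ∀ x : w.SeifertLoop, ε x.column ≠ 1 → v x = 0 := fun x hx =>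
        hv x (Int.units_ne_iff_eq_neg.mp hx)
      simpa using h.neg_mul_seifertForm_pos hv1 hv0)
  have hsig : w.signature = (sigPos w.seifertForm : ℤ) - (sigNeg w.seifertForm : ℤ) := rfl
  rw [hsig, hpos, hneg, Set.ncard_eq_toFinset_card', Set.ncard_eq_toFinset_card',
    Set.toFinset_compl, Set.toFinset_ofPred, Finset.compl_filter, Finset.natCast_card_filter,
    Finset.natCast_card_filter, ← Finset.sum_sub_distrib, ← Finset.sum_neg_distrib]
  refine Finset.sum_congr rfl fun x _ => ?_
  rcases Int.units_eq_one_or (ε x.column) with hx | hx <;> simp [hx]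

end IsAlternatingWith

theorem ncard_fst_get_eq (w : BraidWord k) (i : Fin k) :
    {a : Fin w.length | (w.get a).1 = i}.ncard = (w.map Prod.fst).count i := by
  rw [Set.ncard_eq_toFinset_card', Set.toFinset_ofPred]
  have hcount := Fin.card_filter_univ_eq_vector_get_eq_count i
    (⟨w.map Prod.fst, List.length_map _⟩ : List.Vector (Fin k) w.length)
  simpa [List.Vector.get] using hcount

theorem image_snd_column_eq {i : Fin k} {m : Fin w.length}
    (hm : IsLeast {a | (w.get a).1 = i} m) :
    (fun x : w.SeifertLoop => x.1.2) '' {x | x.column = i} = {a | (w.get a).1 = i} \ {m} := by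
  ext b
  constructor
  · rintro ⟨x, hx, rfl⟩
    exact ⟨x.2.2.1.symm.trans hx, ((hm.2 hx).trans_lt x.2.1).ne'⟩
  · rintro ⟨hb, hbm⟩
    obtain ⟨a, ⟨ha, hab⟩, hmax⟩ := Set.exists_max_image {a | (w.get a).1 = i ∧ a < b} id
      (Set.toFinite _) ⟨m, hm.1, (hm.2 hb).lt_of_ne' hbm⟩
    refine ⟨⟨(a, b), hab, ha.trans hb.symm, fun c hac hcb hc => ?_⟩, ha, rfl⟩
    exact hac.not_ge (hmax c ⟨hc.trans ha, hcb⟩)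

theorem ncard_column_eq (w : BraidWord k) (i : Fin k) :
    {x : w.SeifertLoop | x.column = i}.ncard = (w.map Prod.fst).count i - 1 := by
  rw [← w.ncard_fst_get_eq]
  rcases {a : Fin w.length | (w.get a).1 = i}.eq_empty_or_nonempty with hempty | hne
  · have hloop : {x : w.SeifertLoop | x.column = i} = ∅ :=
      Set.eq_empty_of_forall_notMem fun x hx => Set.eq_empty_iff_forall_notMem.mp hempty x.1.1 hx
    rw [hloop, hempty, Set.ncard_empty, Set.ncard_empty]
  · obtain ⟨m, hm, hmin⟩ := Set.exists_min_image _ id (Set.toFinite _) hne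
    rw [← Set.ncard_image_of_injective _ fun x y => SeifertLoop.eq_of_snd_eq,
      image_snd_column_eq ⟨hm, hmin⟩, Set.ncard_sdiff_singleton_of_mem hm]

theorem IsAlternatingWith.signature_eq {ε : Fin k → ℤˣ} (h : w.IsAlternatingWith ε) :
    w.signature = -∑ i, (ε i : ℤ) * ((w.map Prod.fst).count i - 1 : ℕ) := by
  rw [h.signature_eq_neg_sum, ← Finset.sum_fiberwise' _ SeifertLoop.column fun i => (ε i : ℤ)]
  congr 1
  refine Finset.sum_congr rfl fun i _ => ?_
  rw [Finset.sum_const, ← w.ncard_column_eq, Set.ncard_eq_toFinset_card', Set.toFinset_ofPred,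
    nsmul_eq_mul, mul_comm]

end BraidWord

theorem isAlternatingWith_twoBlockWord (p₁ q₁ r₁ p₂ q₂ r₂ : ℕ) :
    (twoBlockWord p₁ q₁ r₁ p₂ q₂ r₂).IsAlternatingWith ![1, -1, 1] where
  crossingSign_eq a := by
    have hmem : ∀ u ∈ twoBlockWord p₁ q₁ r₁ p₂ q₂ r₂,
        (if u.2 then 1 else -1 : ℤ) = (![1, -1, 1] : Fin 3 → ℤˣ) u.1 := by
      intro u hu
      simp only [twoBlockWord, List.mem_append, List.mem_replicate] at hu
      rcases hu with ((((⟨-, rfl⟩ | ⟨-, rfl⟩) | ⟨-, rfl⟩) | ⟨-, rfl⟩) | ⟨-, rfl⟩) | ⟨-, rfl⟩ <;> rfl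
    exact hmem _ (List.get_mem _ a)
  ne_of_succ_eq {i j} := by
    revert i j
    decide

theorem signature_twoBlockWord {p₁ q₁ r₁ p₂ q₂ r₂ : ℕ} (hp : 0 < p₁ + p₂) (hq : 0 < q₁ + q₂)
    (hr : 0 < r₁ + r₂) :
    (twoBlockWord p₁ q₁ r₁ p₂ q₂ r₂).signature = ((q₁ + q₂ : ℕ) : ℤ) - 1 -
      (((p₁ + p₂ : ℕ) : ℤ) - 1 + (((r₁ + r₂ : ℕ) : ℤ) - 1)) := by
  have hcount (i : Fin 3) : ((twoBlockWord p₁ q₁ r₁ p₂ q₂ r₂).map Prod.fst).count i =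
      ![p₁ + p₂, q₁ + q₂, r₁ + r₂] i := by
    fin_cases i <;> simp [twoBlockWord, List.count_replicate]
  simp only [(isAlternatingWith_twoBlockWord p₁ q₁ r₁ p₂ q₂ r₂).signature_eq, hcount,
    Fin.sum_univ_three, Matrix.cons_val, Units.val_one, Units.val_neg]
  lia

theorem mainTheorem3 (p₁ q₁ r₁ p₂ q₂ r₂ : ℕ) (hp₁ : 0 < p₁) (hq₁ : 0 < q₁) (hr₁ : 0 < r₁)
    (hp₂ : 0 < p₂) (hq₂ : 0 < q₂) (hr₂ : 0 < r₂) :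
    -- the Alexander polynomial, up to a unit of `ℤ[t^{1/2}, t^{-1/2}]`, where `s = -t`
    Associated (alexanderPolynomial (twoBlockWord p₁ q₁ r₁ p₂ q₂ r₂).toBraid)
      (Polynomial.aeval (-(tVar : LaurentPolynomial ℤ))
        (twoBlockPolynomial p₁ q₁ r₁ p₂ q₂ r₂)) ∧
    -- it is symmetric and trapezoidal with nonzero coefficients
    (twoBlockPolynomial p₁ q₁ r₁ p₂ q₂ r₂).IsSymmetric ∧
    (∀ k ≤ (twoBlockPolynomial p₁ q₁ r₁ p₂ q₂ r₂).span,
      (twoBlockPolynomial p₁ q₁ r₁ p₂ q₂ r₂).shiftedCoeff k ≠ 0) ∧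
    (twoBlockPolynomial p₁ q₁ r₁ p₂ q₂ r₂).IsTrapezoidal ∧
    -- the length of its stable part is at most the absolute value of the signature
    ∃ l : ℕ, (twoBlockPolynomial p₁ q₁ r₁ p₂ q₂ r₂).IsStableLength l ∧
      (l : ℤ) ≤ |(twoBlockWord p₁ q₁ r₁ p₂ q₂ r₂).signature| := by
  obtain ⟨c, i, h, hle⟩ := exists_isSymmTrapezoid_twoBlockPolynomial hp₁ hq₁ hr₁ hp₂ hq₂ hr₂
  refine ⟨associated_alexanderPolynomial_twoBlockWord p₁ q₁ r₁ p₂ q₂ r₂, h.isSymmetric,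
    fun k hk => h.shiftedCoeff_ne_zero hk, h.isTrapezoidal, _, h.isStableLength, ?_⟩
  rw [signature_twoBlockWord (by lia) (by lia) (by lia),
    Int.toNat_of_nonneg (sub_nonneg.mpr h.two_mul_le)]
  exact hle
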